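/- Let $n=2^k$. The DAG of the $n$-input balanced merging network (BMN) has the nodes $\langle w,l\rangle$ with $0\le w<n$, $0\le l\le \log n$; for $l<\log n$ the node $\langle w,l\rangle$ has arcs exactly to $\langle w,l+1\rangle$ and to $\langle w',l+1\rangle$, where $w'=(i+1)n/2^l-1-j$, $i=\lfloor w2^l/n\rfloor$ and $j=w \bmod (n/2^l)$. The DAG of the $n$-input periodic balanced sorting network (PBSN) is the concatenation of $\log n$ copies (blocks) of the BMN, the output $\langle w,\log n\rangle$ of each block being identified with the input $\langle w,0\rangle$ of the next. A BSP execution with $p$ processors is a sequence of supersteps in which processors compute locally and exchange messages; a message carries at most one node value and is visible to its receiver from the next superstep on. The degree $h_j$ of superstep $j$ is the maximum number of messages sent or received by any processor in it, and the BSP communication complexity is $H=\sum_j h_j$. The execution evaluates a DAG without recomputation if every node is evaluated exactly once, by one processor at one time; an input node is evaluated by a processor to which that input is initially available; whenever a node is evaluated, the values of its predecessors are in the memory of the evaluating processor (evaluated there earlier, or received in a message sent in an earlier superstep); and processors only send node values that they have evaluated or received. Theorem. Let $\mathcal A$ be any BSP execution with $p\le 2n/e$ processors that evaluates the DAG of the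 $n$-input PBSN without recomputation, each input being initially available to exactly one processor. Let $q$ be the maximum, over all blocks and all processors, of the number of output nodes of the block that are evaluated by the processor. If $q\le n/2$, then the BSP communication complexity of $\mathcal A$ satisfies \[ H_{\mathcal A} > \frac{n\log (n/2)}{8p\log(2n/p)}\left\lceil\frac{\log n}{2}\right\rceil , \] where $\log$ denotes the logarithm to base $2$. -/

import Mathlib

open Finset

/-- A computation DAG: a directed graph without directed cycles. -/
structure CompDAG (V : Type*) extends Digraph V where
  acyclic : ∀ v : V, ¬ Relation.TransGen Adj v v

/-- An input node is a node without predecessors. -/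
def CompDAG.IsInput {V : Type*} (G : CompDAG V) (v : V) : Prop :=
  ∀ u : V, ¬ G.Adj u v

/-! ### Balanced merging network and periodic balanced sorting network -/

/-- The nodes `⟨w, l⟩` of the `2 ^ k`-input balanced merging network: `0 ≤ w < 2 ^ k`, `0 ≤ l ≤ k`. -/
abbrev BMNNode (k : ℕ) : Type := Fin (2 ^ k) × Fin (k + 1)

/-- The arcs of the balanced merging network on `n = 2 ^ k` inputs. With `i = ⌊w 2 ^ l / n⌋` and
`j = w mod (n / 2 ^ l)`, the node `⟨w, l⟩` with `l < k` has an arc to `⟨w, l + 1⟩` and an arc to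
`⟨w', l + 1⟩` where `w' = (i + 1) n / 2 ^ l - 1 - j`: the mirror image of `w` inside its
group of `n / 2 ^ l` consecutive indices. -/
def BMNArc (k : ℕ) (a b : BMNNode k) : Prop :=
  (b.2 : ℕ) = (a.2 : ℕ) + 1 ∧
    (b.1 = a.1 ∨
      (b.1 : ℕ) =
        ((a.1 : ℕ) * 2 ^ (a.2 : ℕ) / 2 ^ k + 1) * (2 ^ k / 2 ^ (a.2 : ℕ)) - 1
          - (a.1 : ℕ) % (2 ^ k / 2 ^ (a.2 : ℕ)))

/-- The nodes of the `2 ^ k`-input periodic balanced sorting network, which has `k` blocks of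
depth `k`: level `b * k` holds the inputs of block `b` (for `b < k`), and level `(b + 1) * k`
holds its outputs, which are the inputs of the next block. -/
abbrev PBSNNode (k : ℕ) : Type := Fin (2 ^ k) × Fin (k * k + 1)

/-- The position of a node of the balanced merging network in the `b`-th block. -/
def blockNode (k : ℕ) (b : Fin k) (a : BMNNode k) : PBSNNode k :=
  (a.1, ⟨(b : ℕ) * k + (a.2 : ℕ), by
    have h1 := a.2.isLt
    have h2 : ((b : ℕ) + 1) * k ≤ k * k := Nat.mul_le_mul_right k b.isLt
    have h3 : ((b : ℕ) + 1) * k = (b : ℕ) * k + k := Nat.succ_mul _ _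
    omega⟩)

/-- The arcs of the periodic balanced sorting network are the arcs of its `k` blocks. -/
def PBSNArc (k : ℕ) (x y : PBSNNode k) : Prop :=
  ∃ (b : Fin k) (u v : BMNNode k), BMNArc k u v ∧ x = blockNode k b u ∧ y = blockNode k b v

theorem PBSNArc.level_lt {k : ℕ} {x y : PBSNNode k} (h : PBSNArc k x y) : x.2 < y.2 := by
  obtain ⟨b, u, v, huv, rfl, rfl⟩ := h
  have := huv.1
  simp only [blockNode, Fin.lt_def]
  omega

/-- The DAG of the periodic balanced sorting network on `2 ^ k` inputs. -/
def PBSN (k : ℕ) : CompDAG (PBSNNode k) where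
  Adj := PBSNArc k
  acyclic := by
    have key : ∀ x y : PBSNNode k, Relation.TransGen (PBSNArc k) x y → x.2 < y.2 := by
      intro x y h
      induction h with
      | single h => exact h.level_lt
      | tail _ h ih => exact ih.trans h.level_lt
    exact fun v h => lt_irrefl _ (key v v h)

/-- The `w`-th output node of the `b`-th block. -/
def blockOutput (k : ℕ) (b : Fin k) (w : Fin (2 ^ k)) : PBSNNode k :=
  blockNode k b (w, Fin.last k)

/-! ### Executions on a BSP with `p` processors -/

/-- A processor-time pair; a time is a superstep together with a local time inside it. -/
structure ProcTime (p K : ℕ) where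
  proc : Fin p
  step : Fin K
  time : ℕ

/-- `e` is strictly earlier than `f`. -/
def ProcTime.Before {p K : ℕ} (e f : ProcTime p K) : Prop :=
  e.step < f.step ∨ (e.step = f.step ∧ e.time < f.time)

/-- The data of an execution on a BSP with `p` processors, in relation to a DAG with nodes `V`.
A message carries the value of one node (`some u`), or a word that is not the value of a
node (`none`). -/
structure BSPExecution (V : Type*) (p : ℕ) where
  /-- the number of supersteps -/
  steps : ℕ
  /-- `messages j P Q` are the messages that `P` sends to `Q` in superstep `j` -/
  messages : Fin steps → Fin p → Fin p → Multiset (Option V)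
  /-- `initial P` is the set of input nodes whose values are initially available to `P` -/
  initial : Fin p → Set V
  /-- `sched v` is the set of processor-time pairs at which `v` is evaluated -/
  sched : V → Set (ProcTime p steps)

namespace BSPExecution

variable {V : Type*} {p : ℕ}

/-- The processor `P` has received the value of `u` in a message sent before superstep `j`. A message
sent in a superstep is visible to the receiver only from the next superstep on. -/
def Received (A : BSPExecution V p) (j : Fin A.steps) (P : Fin p) (u : V) : Prop :=
  ∃ i : Fin A.steps, i < j ∧ ∃ Q : Fin p, some u ∈ A.messages i Q P

/-- The execution evaluates the DAG `G`. -/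
structure Evaluates (A : BSPExecution V p) (G : CompDAG V) : Prop where
  /-- every node is evaluated -/
  evaluated : ∀ v, (A.sched v).Nonempty
  /-- an input node is evaluated by reading a value that is initially available -/
  input : ∀ v, G.IsInput v → ∀ e ∈ A.sched v, v ∈ A.initial e.proc
  /-- when a node is evaluated, the values of all its predecessors are in the local memory: they
  were evaluated earlier by the same processor, or received in an earlier superstep -/
  operand : ∀ u v, G.Adj u v → ∀ e ∈ A.sched v,
    (∃ f ∈ A.sched u, f.proc = e.proc ∧ f.Before e) ∨ A.Received e.step e.proc u
  /-- a processor can send only the values that are in its local memory: those it has evaluated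
  up to the present superstep, and those it has received from earlier supersteps -/
  message : ∀ (j : Fin A.steps) (P Q : Fin p) (u : V), some u ∈ A.messages j P Q →
    (∃ f ∈ A.sched u, f.proc = P ∧ f.step ≤ j) ∨ A.Received j P u

/-- Every node is evaluated exactly once. -/
def WithoutRecomputation (A : BSPExecution V p) : Prop :=
  ∀ v, ∃ e, A.sched v = {e}

/-- The degree of a superstep: the maximum number of messages sent or received by a processor. -/
def degree (A : BSPExecution V p) (j : Fin A.steps) : ℕ :=
  univ.sup fun P : Fin p =>
    max (∑ Q, (A.messages j P Q).card) (∑ Q, (A.messages j Q P).card)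

/-- The BSP communication complexity: the sum of the degrees of the supersteps. -/
def commComplexity (A : BSPExecution V p) : ℕ :=
  ∑ j, A.degree j

/-- The number of output nodes of block `b` that are evaluated by the processor `P`. -/
noncomputable def blockOutputCount {k : ℕ} (A : BSPExecution (PBSNNode k) p) (b : Fin k)
    (P : Fin p) : ℕ :=
  {w : Fin (2 ^ k) | ∃ e ∈ A.sched (blockOutput k b w), e.proc = P}.ncard

/-- The maximum number of output nodes of a block that are evaluated by a processor. -/
noncomputable def maxBlockOutputCount {k : ℕ} (A : BSPExecution (PBSNNode k) p) : ℕ :=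
  univ.sup fun x : Fin k × Fin p => A.blockOutputCount x.1 x.2

end BSPExecution

/-! In Gray code each block is a butterfly: an arc of level `l` changes at most coordinate `l`.
Setting its `k * 2 ^ (k - 1)` switches routes `n = 2 ^ k` tokens along node-disjoint paths, and
since paths are unique, distinct settings give distinct permutations.

Fix a block; let `H` be the communication between the evaluation of its first input and that of its
last output, `q` the largest number of its outputs at one processor, and `M = 2 * n / p`. Let a
token change processors when the node it leaves is first sent by its owner. In a superstep of degree
`h` each processor first sends at most `h` relevant nodes, each left by at most one of the tokens
located there, in one of two directions. By AM-GM the number of possible location vectors grows by a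
factor of at most `(M + 1) ^ (p * h)`. The final locations leave at most `q` outputs per token, so
`2 ^ (k * 2 ^ (k - 1)) ≤ (M + 1) ^ (p * H) * q ^ n` (`two_pow_le_of_crossingsOrdered`).

This is weak for large `q`. There a count of input-output paths across the cut around one processor
gives `q ≤ 2 * H` (`ncard_outputs_le`). Together the bounds yield `n * (k - 1) < 8 * p * H * log M`
(`block_inequality`).

The windows of blocks `b` and `b' ≥ b + 2` are disjoint, because every output of the block in
between depends on all its inputs. Hence the bounds add up over the even-numbered blocks. -/

/-! ### Switch settings of the butterfly -/

/-- The arcs from level `l` to level `l + 1` of the butterfly: the two labels agree off the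
coordinate `l`. -/
def ButterflyArc {k : ℕ} (l : ℕ) (x y : Fin k → Bool) : Prop :=
  ∀ i : Fin k, (i : ℕ) ≠ l → x i = y i

/-- A setting of all switches of the butterfly; the switch of level `l` that contains a label is
given by the coordinates of the label other than `l`. -/
abbrev SwitchSetting (k : ℕ) : Type := (l : Fin k) → ({i : Fin k // i ≠ l} → Bool) → Bool

namespace SwitchSetting

variable {k : ℕ}

theorem card_eq : Fintype.card (SwitchSetting k) = 2 ^ (k * 2 ^ (k - 1)) := by
  have h : ∀ l : Fin k, Fintype.card {i : Fin k // i ≠ l} = k - 1 := by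
    intro l
    rw [Fintype.card_subtype_compl]
    simp
  simp only [SwitchSetting, Fintype.card_pi, Fintype.card_bool, prod_const, card_univ, h,
    Fintype.card_fin]
  rw [← pow_mul, mul_comm]

/-- The effect of the switches of level `l`. -/
def move (c : SwitchSetting k) (l : ℕ) (x : Fin k → Bool) : Fin k → Bool := fun i =>
  if (i : ℕ) = l then xor (x i) (c i fun m => x m) else x i

theorem move_of_ne (c : SwitchSetting k) {l : ℕ} (x : Fin k → Bool) {i : Fin k}
    (h : (i : ℕ) ≠ l) : c.move l x i = x i := if_neg h

theorem move_self (c : SwitchSetting k) (l : Fin k) (x : Fin k → Bool) :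
    c.move l x l = xor (x l) (c l fun m => x m) := if_pos rfl

theorem move_involutive (c : SwitchSetting k) (l : ℕ) : Function.Involutive (c.move l) := by
  intro x
  funext i
  by_cases hi : (i : ℕ) = l
  · subst hi
    have h : (fun m : {m : Fin k // m ≠ i} => c.move i x m) =
        fun m : {m : Fin k // m ≠ i} => x m := by
      funext m
      exact c.move_of_ne x fun h => m.2 (Fin.ext h)
    rw [move_self, h, move_self]
    simp
  · rw [move_of_ne _ _ hi, move_of_ne _ _ hi]

/-- The label at level `l` of the token that starts at the input `t`. -/
def position (c : SwitchSetting k) : ℕ → (Fin k → Bool) → Fin k → Bool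
  | 0, t => t
  | l + 1, t => c.move l (c.position l t)

theorem position_injective (c : SwitchSetting k) (l : ℕ) : Function.Injective (c.position l) := by
  induction l with
  | zero => exact fun _ _ h => h
  | succ l ih => exact fun _ _ h => ih ((c.move_involutive l).injective h)

theorem arc_position (c : SwitchSetting k) (l : ℕ) (t : Fin k → Bool) :
    ButterflyArc l (c.position l t) (c.position (l + 1) t) :=
  fun _ hi => (c.move_of_ne _ hi).symm

theorem position_of_le (c : SwitchSetting k) (t : Fin k → Bool) (i : Fin k) (m : ℕ)
    (h : m ≤ (i : ℕ)) : c.position m t i = t i := by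
  induction m with
  | zero => rfl
  | succ m ih => exact (c.move_of_ne _ (by omega)).trans (ih (by omega))

theorem position_of_lt (c : SwitchSetting k) (t : Fin k → Bool) (i : Fin k) {m m' : ℕ}
    (h : (i : ℕ) < m) (hm : m ≤ m') : c.position m' t i = c.position m t i := by
  induction m', hm using Nat.le_induction with
  | base => rfl
  | succ m' hm ih => exact (c.move_of_ne _ (by omega)).trans ih

/-- The permutation realized by a setting determines the setting, as paths are unique. -/
theorem position_top_injective :
    Function.Injective fun c : SwitchSetting k => c.position k := by
  intro c c' h
  -- Coordinate `i` can change only at level `i`, so input and output determine the whole path.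
  have key : ∀ m ≤ k, c.position m = c'.position m := by
    intro m hm
    funext t i
    by_cases hi : (i : ℕ) < m
    · rw [← c.position_of_lt t i hi hm, ← c'.position_of_lt t i hi hm]
      exact congrFun (congrFun h t) i
    · rw [c.position_of_le t i m (by omega), c'.position_of_le t i m (by omega)]
  funext l f
  -- Either of the two labels on the switch `f` serves; the value at `l` is arbitrary.
  let x : Fin k → Bool := fun i => if hi : i ≠ l then f ⟨i, hi⟩ else false
  have hx : (fun m : {i : Fin k // i ≠ l} => x m) = f := by
    funext m
    exact dif_pos m.2
  obtain ⟨t, ht⟩ := (Finite.injective_iff_surjective.1 (c.position_injective l)) x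
  have ht' : c'.position l t = x := by rw [← key l l.isLt.le, ht]
  have h1 := congrFun (congrFun (key (l + 1) l.isLt) t) l
  change c.move l (c.position l t) l = c'.move l (c'.position l t) l at h1
  rw [ht, ht', move_self, move_self, hx] at h1
  exact Bool.xor_right_inj.1 h1

end SwitchSetting

/-! ### The location of a token that follows a path -/

/-- A token follows a path whose `m`-th node belongs to `o m`, and it crosses over from the owner
of the `m`-th node to the owner of the next node at time `s m`. Its location at time `j` is the
owner of the node from which it makes the first crossing that is not made before `j`. -/
noncomputable def location {β : Type*} (k : ℕ) (o : ℕ → β) (s : ℕ → ℕ) (j : ℕ) : β :=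
  -- The index `k` keeps the set nonempty: a token with no crossing left is located at the owner of
  -- its output.
  o (sInf {m | m = k ∨ (m < k ∧ o m ≠ o (m + 1) ∧ j ≤ s m)})

theorem eq_of_forall_succ_eq {β : Type*} {o : ℕ → β} {a b : ℕ} (hab : a ≤ b)
    (h : ∀ i, a ≤ i → i < b → o i = o (i + 1)) : o a = o b := by
  induction b, hab using Nat.le_induction with
  | base => rfl
  | succ b hb ih => exact (ih fun i h1 h2 => h i h1 (by omega)).trans (h b hb (by omega))

section location

variable {β : Type*} {k : ℕ} {o : ℕ → β} {s : ℕ → ℕ}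

theorem location_zero : location k o s 0 = o 0 := by
  set S := {m | m = k ∨ (m < k ∧ o m ≠ o (m + 1) ∧ 0 ≤ s m)} with hS
  have hk : sInf S ≤ k := Nat.sInf_le (Or.inl rfl)
  change o (sInf S) = o 0
  refine (eq_of_forall_succ_eq (Nat.zero_le _) fun i _ hi => ?_).symm
  by_contra hne
  exact Nat.notMem_of_lt_sInf hi (Or.inr ⟨by omega, hne, Nat.zero_le _⟩)

theorem location_of_forall_lt {j : ℕ} (h : ∀ m < k, o m ≠ o (m + 1) → s m < j) :
    location k o s j = o k := by
  unfold location
  congr 1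
  have hk : sInf {m | m = k ∨ (m < k ∧ o m ≠ o (m + 1) ∧ j ≤ s m)} ∈ _ :=
    Nat.sInf_mem ⟨k, Or.inl rfl⟩
  rcases hk with hk | ⟨h1, h2, h3⟩
  · exact hk
  · exact absurd (h _ h1 h2) (by omega)

theorem location_succ_of_forall_ne {j : ℕ} (h : ∀ m < k, o m ≠ o (m + 1) → s m ≠ j) :
    location k o s (j + 1) = location k o s j := by
  unfold location
  congr 2
  ext m
  refine or_congr_right (and_congr_right fun hm => and_congr_right fun hne => ?_)
  have := h m hm hne
  omega

theorem location_of_crossing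
    (hs : ∀ l l', l < l' → l' < k → o l ≠ o (l + 1) → o l' ≠ o (l' + 1) → s l < s l')
    {l : ℕ} (hl : l < k) (hne : o l ≠ o (l + 1)) :
    location k o s (s l) = o l := by
  unfold location
  congr 1
  refine le_antisymm (Nat.sInf_le (Or.inr ⟨hl, hne, le_rfl⟩)) ?_
  refine le_csInf ⟨k, Or.inl rfl⟩ ?_
  rintro m (rfl | ⟨hm, hm1, hm2⟩)
  · exact hl.le
  · by_contra hlt
    have := hs m l (by omega) hl hm1 hne
    omega

theorem location_succ_of_crossing
    (hs : ∀ l l', l < l' → l' < k → o l ≠ o (l + 1) → o l' ≠ o (l' + 1) → s l < s l')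
    {l : ℕ} (hl : l < k) (hne : o l ≠ o (l + 1)) :
    location k o s (s l + 1) = o (l + 1) := by
  set S := {m | m = k ∨ (m < k ∧ o m ≠ o (m + 1) ∧ s l + 1 ≤ s m)} with hS
  have hk : sInf S ≤ k := Nat.sInf_le (Or.inl rfl)
  have hlt : l + 1 ≤ sInf S := by
    refine le_csInf ⟨k, Or.inl rfl⟩ ?_
    rintro m (rfl | ⟨hm, hm1, hm2⟩)
    · exact hl
    · by_contra hlt
      rcases Nat.lt_or_ge m l with h | h
      · have := hs m l h hl hm1 hne
        omega
      · obtain rfl : m = l := by omega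
        omega
  change o (sInf S) = o (l + 1)
  refine (eq_of_forall_succ_eq hlt fun i hi1 hi2 => ?_).symm
  by_contra hne'
  exact Nat.notMem_of_lt_sInf hi2
    (Or.inr ⟨by omega, hne', hs l i (by omega) (by omega) hne hne'⟩)

end location

/-! ### The inequality of arithmetic and geometric means. -/

theorem prod_le_mean_pow {ι : Type*} [Fintype ι] [Nonempty ι] (f : ι → ℝ) (hf : ∀ i, 0 ≤ f i)
    {a : ℝ} (ha : 0 < a) (h : ∑ i, f i ≤ Fintype.card ι * a) :
    ∏ i, f i ≤ a ^ Fintype.card ι := by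
  have h1 : ∀ i, f i ≤ a * Real.exp (f i / a - 1) := by
    intro i
    have := Real.add_one_le_exp (f i / a - 1)
    calc f i = a * (f i / a - 1 + 1) := by field_simp; ring
      _ ≤ _ := by gcongr
  calc ∏ i, f i ≤ ∏ i, (a * Real.exp (f i / a - 1)) :=
        prod_le_prod (fun i _ => hf i) fun i _ => h1 i
    _ = a ^ Fintype.card ι * Real.exp ((∑ i, f i) / a - Fintype.card ι) := by
        rw [prod_mul_distrib, prod_const, card_univ, ← Real.exp_sum, sum_sub_distrib, sum_div]
        simp
    _ ≤ a ^ Fintype.card ι * 1 := by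
        gcongr
        rw [Real.exp_le_one_iff, sub_nonpos, div_le_iff₀ ha]
        exact h
    _ = _ := mul_one _

/-! ### Counting the locations of the tokens -/

section counting

variable {k p : ℕ} (owner : ℕ → (Fin k → Bool) → Fin p) (sent : ℕ → (Fin k → Bool) → ℕ)

/-- The location of every token at time `j`. -/
noncomputable def tokenLocation (j : ℕ) (c : SwitchSetting k) (t : Fin k → Bool) : Fin p :=
  location k (fun m => owner m (c.position m t)) (fun m => sent m (c.position m t)) j

/-- The nodes of `P` that `P` first sends at time `j`, among those with a successor that belongs to
another processor. -/
def firstSent (j : ℕ) (P : Fin p) : Set (Fin k × (Fin k → Bool)) :=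
  {u | owner u.1 u.2 = P ∧ sent u.1 u.2 = j ∧
    ∃ y, ButterflyArc u.1 u.2 y ∧ owner (u.1 + 1) y ≠ P}

open Classical in
/-- The records of the crossings that are made at time `j` when the locations of the tokens are
`D`: for a node that is first sent at that time, the token that leaves it and a coordinate of the
node to which it goes. -/
noncomputable def crossingRecords (j : ℕ) (D : (Fin k → Bool) → Fin p)
    (u : Fin k × (Fin k → Bool)) : Finset (Option ((Fin k → Bool) × Bool)) :=
  if u ∈ firstSent owner sent j (owner u.1 u.2) then
    insertNone (univ.filter (fun t => D t = owner u.1 u.2) ×ˢ univ)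
  else {none}

open Classical in
/-- The locations of the tokens after the recorded crossings. -/
noncomputable def applyRecord (D : (Fin k → Bool) → Fin p)
    (r : Fin k × (Fin k → Bool) → Option ((Fin k → Bool) × Bool)) (t : Fin k → Bool) : Fin p :=
  if h : ∃ u : (Fin k × (Fin k → Bool)) × Bool, r u.1 = some (t, u.2) then
    owner (h.choose.1.1 + 1) (Function.update h.choose.1.2 h.choose.1.1 h.choose.2)
  else D t

theorem update_position (c : SwitchSetting k) (l : Fin k) (t : Fin k → Bool) :
    Function.update (c.position l t) l (c.position (l + 1) t l) = c.position (l + 1) t := by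
  funext i
  by_cases hi : i = l
  · subst hi
    simp
  · rw [Function.update_of_ne hi]
    exact c.arc_position l t i fun h => hi (Fin.ext h)

/-- A token makes its crossings one after the other. -/
def CrossingsOrdered : Prop :=
  ∀ u : ℕ → Fin k → Bool, (∀ l < k, ButterflyArc l (u l) (u (l + 1))) →
    ∀ l l', l < l' → l' < k → owner l (u l) ≠ owner (l + 1) (u (l + 1)) →
      owner l' (u l') ≠ owner (l' + 1) (u (l' + 1)) → sent l (u l) < sent l' (u l')

variable {owner sent}

/-- A token that crosses at time `j` is then located at the owner of the node it leaves. No other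
token passes through that node, and the node together with the new value of its level's coordinate
determines the next node. So the change of locations is encoded without knowledge of the setting. -/
theorem tokenLocation_succ_mem (hs : CrossingsOrdered owner sent) (j : ℕ) (c : SwitchSetting k) :
    ∃ r, (∀ u, r u ∈ crossingRecords owner sent j (tokenLocation owner sent j c) u) ∧
      tokenLocation owner sent (j + 1) c =
        applyRecord owner (tokenLocation owner sent j c) r := by
  classical
  have hs' := fun t => hs (fun m => c.position m t) (fun l _ => c.arc_position l t)
  let C : Fin k × (Fin k → Bool) → (Fin k → Bool) → Prop := fun u t =>
    c.position u.1 t = u.2 ∧ sent u.1 u.2 = j ∧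
      owner u.1 u.2 ≠ owner (u.1 + 1) (c.position (u.1 + 1) t)
  have hC1 : ∀ u t, C u t → tokenLocation owner sent j c t = owner u.1 u.2 := by
    rintro ⟨l, x⟩ t ⟨hx, rfl, h⟩
    obtain rfl : c.position l t = x := hx
    exact location_of_crossing (hs' t) l.isLt h
  have hC2 : ∀ u t, C u t → tokenLocation owner sent (j + 1) c t =
      owner (u.1 + 1) (c.position (u.1 + 1) t) := by
    rintro ⟨l, x⟩ t ⟨hx, rfl, h⟩
    obtain rfl : c.position l t = x := hx
    exact location_succ_of_crossing (hs' t) l.isLt h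
  have hC3 : ∀ t, (¬ ∃ u, C u t) →
      tokenLocation owner sent (j + 1) c t = tokenLocation owner sent j c t := by
    intro t h
    refine location_succ_of_forall_ne fun m hm hne hj => h ⟨(⟨m, hm⟩, c.position m t), rfl, hj, hne⟩
  let r : Fin k × (Fin k → Bool) → Option ((Fin k → Bool) × Bool) := fun u =>
    if h : ∃ t, C u t then some (h.choose, c.position (u.1 + 1) h.choose u.1) else none
  have hr1 : ∀ u t b, r u = some (t, b) → C u t ∧ b = c.position (u.1 + 1) t u.1 := by
    intro u t b h
    by_cases hex : ∃ t, C u t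
    · simp only [r, dif_pos hex, Option.some.injEq, Prod.mk.injEq] at h
      obtain ⟨rfl, rfl⟩ := h
      exact ⟨hex.choose_spec, rfl⟩
    · simp [r, dif_neg hex] at h
  have hr2 : ∀ u t, C u t → r u = some (t, c.position (u.1 + 1) t u.1) := by
    intro u t h
    have hex : ∃ t, C u t := ⟨t, h⟩
    have : hex.choose = t := c.position_injective u.1 (hex.choose_spec.1.trans h.1.symm)
    simp only [r, dif_pos hex, this]
  refine ⟨r, fun u => ?_, ?_⟩
  · rcases h : r u with _ | ⟨t, b⟩
    · unfold crossingRecords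
      split_ifs <;> simp
    · obtain ⟨hC, -⟩ := hr1 u t b h
      have hmem : u ∈ firstSent owner sent j (owner u.1 u.2) :=
        ⟨rfl, hC.2.1, _, hC.1 ▸ c.arc_position u.1 t, hC.2.2.symm⟩
      unfold crossingRecords
      rw [if_pos hmem]
      simp [hC1 u t hC]
  · funext t
    unfold applyRecord
    split_ifs with h
    · obtain ⟨hC, hb⟩ := hr1 _ _ _ h.choose_spec
      rw [hC2 _ _ hC, hb, ← hC.1, update_position]
    · refine hC3 t fun ⟨u, hu⟩ => h ⟨(u, c.position (u.1 + 1) t u.1), hr2 u t hu⟩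

/-- If `d` tokens are located at a processor, each of its at most `h` first-sent nodes has `2 * d +
1` possible records. These factors sum to `2 * 2 ^ k + p` over the processors, so AM-GM applies. -/
theorem prod_card_crossingRecords_le (hp : 0 < p) (j h : ℕ)
    (hh : ∀ P, (firstSent owner sent j P).ncard ≤ h) (D : (Fin k → Bool) → Fin p) :
    ((∏ u, (crossingRecords owner sent j D u).card : ℕ) : ℝ) ≤
      (2 * 2 ^ k / p + 1 : ℝ) ^ (p * h) := by
  classical
  have : Nonempty (Fin p) := ⟨⟨0, hp⟩⟩
  have hp' : (0 : ℝ) < p := by exact_mod_cast hp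
  let m : Fin p → ℕ := fun P => (univ.filter fun t => D t = P).card * 2 + 1
  have hm : ∑ P, (m P : ℝ) = 2 * 2 ^ k + p := by
    have : ∑ P, (univ.filter fun t => D t = P).card = 2 ^ k := by
      rw [← card_eq_sum_card_fiberwise (fun t _ => mem_univ (D t))]
      simp
    have h2 : ∑ P, m P = 2 * 2 ^ k + p := by
      simp only [m, sum_add_distrib, ← sum_mul, this]
      simp [mul_comm]
    exact_mod_cast h2
  have h1 : ∏ u, (crossingRecords owner sent j D u).card ≤ ∏ P, m P ^ h := by
    rw [← prod_fiberwise univ (fun u : Fin k × (Fin k → Bool) => owner u.1 u.2)]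
    refine prod_le_prod' fun P _ => ?_
    calc ∏ u ∈ univ.filter (fun u : Fin k × (Fin k → Bool) => owner u.1 u.2 = P),
          (crossingRecords owner sent j D u).card
        = ∏ u ∈ univ.filter (fun u : Fin k × (Fin k → Bool) => owner u.1 u.2 = P),
          if u ∈ firstSent owner sent j P then m P else 1 := by
          refine prod_congr rfl fun u hu => ?_
          obtain rfl := (mem_filter.1 hu).2
          unfold crossingRecords
          split_ifs <;> simp [m]
      _ = m P ^ ((univ.filter (fun u : Fin k × (Fin k → Bool) => owner u.1 u.2 = P)).filter
          (· ∈ firstSent owner sent j P)).card := by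
          rw [← prod_filter, prod_const]
      _ ≤ m P ^ h := by
          refine Nat.pow_le_pow_right (by simp [m]) (le_trans ?_ (hh P))
          rw [← Set.ncard_coe_finset]
          refine Set.ncard_le_ncard (fun u hu => ?_) (Set.toFinite _)
          exact (mem_filter.1 hu).2
  calc ((∏ u, (crossingRecords owner sent j D u).card : ℕ) : ℝ)
      ≤ ((∏ P, m P ^ h : ℕ) : ℝ) := by exact_mod_cast h1
    _ = (∏ P, (m P : ℝ)) ^ h := by
        rw [Nat.cast_prod, ← prod_pow]
        exact prod_congr rfl fun P _ => Nat.cast_pow _ _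
    _ ≤ ((2 * 2 ^ k / p + 1 : ℝ) ^ p) ^ h := by
        refine pow_le_pow_left₀ (prod_nonneg fun P _ => Nat.cast_nonneg _) ?_ h
        have := prod_le_mean_pow (fun P => (m P : ℝ)) (fun P => Nat.cast_nonneg (m P))
          (a := 2 * 2 ^ k / p + 1) (by positivity) (by
            rw [hm, Fintype.card_fin]
            rw [mul_add, mul_one, mul_div_cancel₀ _ hp'.ne'])
        rwa [Fintype.card_fin] at this
    _ = _ := (pow_mul _ _ _).symm

theorem card_tokenLocation_le (hp : 0 < p) (hs : CrossingsOrdered owner sent) (h : ℕ → ℕ)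
    (hh : ∀ j P, (firstSent owner sent j P).ncard ≤ h j) (J : ℕ) :
    ((univ.image (tokenLocation owner sent J)).card : ℝ) ≤
      (2 * 2 ^ k / p + 1 : ℝ) ^ (p * ∑ j ∈ range J, h j) := by
  classical
  induction J with
  | zero =>
    -- Before any crossing all tokens are at the owners of their inputs, whatever the setting.
    have : univ.image (tokenLocation owner sent 0) ⊆ {owner 0} := by
      intro D hD
      obtain ⟨c, -, rfl⟩ := mem_image.1 hD
      exact mem_singleton.2 (funext fun t => location_zero)
    have := card_le_card this
    simpa using this
  | succ J ih =>
    have hsub : univ.image (tokenLocation owner sent (J + 1)) ⊆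
        (univ.image (tokenLocation owner sent J)).biUnion fun D =>
          (Fintype.piFinset (crossingRecords owner sent J D)).image (applyRecord owner D) := by
      intro D hD
      obtain ⟨c, -, rfl⟩ := mem_image.1 hD
      obtain ⟨r, hr, h1⟩ := tokenLocation_succ_mem hs J c
      exact mem_biUnion.2 ⟨_, mem_image_of_mem _ (mem_univ c),
        mem_image.2 ⟨r, Fintype.mem_piFinset.2 hr, h1.symm⟩⟩
    calc ((univ.image (tokenLocation owner sent (J + 1))).card : ℝ)
        ≤ ((∑ D ∈ univ.image (tokenLocation owner sent J),
            ∏ u, (crossingRecords owner sent J D u).card : ℕ) : ℝ) := by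
          refine Nat.cast_le.2 ((card_le_card hsub).trans (card_biUnion_le.trans ?_))
          refine sum_le_sum fun D _ => card_image_le.trans ?_
          rw [Fintype.card_piFinset]
      _ ≤ ∑ D ∈ univ.image (tokenLocation owner sent J), (2 * 2 ^ k / p + 1 : ℝ) ^ (p * h J) := by
          rw [Nat.cast_sum]
          exact sum_le_sum fun D _ => prod_card_crossingRecords_le hp J (h J) (hh J) D
      _ ≤ (2 * 2 ^ k / p + 1 : ℝ) ^ (p * ∑ j ∈ range J, h j) *
            (2 * 2 ^ k / p + 1 : ℝ) ^ (p * h J) := by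
          rw [sum_const, nsmul_eq_mul]
          gcongr
      _ = _ := by rw [← pow_add, ← mul_add, sum_range_succ]

/-- The number of permutations that the butterfly realizes is bounded in terms of the numbers of
nodes that are sent. -/
theorem two_pow_le_of_crossingsOrdered (hp : 0 < p) (hs : CrossingsOrdered owner sent) (h : ℕ → ℕ)
    (hh : ∀ j P, (firstSent owner sent j P).ncard ≤ h j) (J : ℕ)
    (hJ : ∀ l < k, ∀ x y, ButterflyArc l x y → owner l x ≠ owner (l + 1) y → sent l x < J) (q : ℕ)
    (hq : ∀ P, {x | owner k x = P}.ncard ≤ q) :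
    (2 : ℝ) ^ (k * 2 ^ (k - 1)) ≤
      (2 * 2 ^ k / p + 1 : ℝ) ^ (p * ∑ j ∈ range J, h j) * q ^ 2 ^ k := by
  classical
  -- After all crossings a token is located at the owner of its output.
  have hsub : univ.image (fun c : SwitchSetting k => c.position k) ⊆
      (univ.image (tokenLocation owner sent J)).biUnion fun D =>
        Fintype.piFinset fun t => univ.filter fun x => owner k x = D t := by
    intro π hπ
    obtain ⟨c, -, rfl⟩ := mem_image.1 hπ
    refine mem_biUnion.2 ⟨_, mem_image_of_mem _ (mem_univ c), Fintype.mem_piFinset.2 fun t => ?_⟩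
    have := location_of_forall_lt (k := k) (o := fun m => owner m (c.position m t))
      (s := fun m => sent m (c.position m t)) (j := J)
      fun m hm hne => hJ m hm _ _ (c.arc_position m t) hne
    exact mem_filter.2 ⟨mem_univ _, this.symm⟩
  have h1 : 2 ^ (k * 2 ^ (k - 1)) ≤ (univ.image (tokenLocation owner sent J)).card * q ^ 2 ^ k := by
    rw [← SwitchSetting.card_eq, ← card_univ,
      ← card_image_of_injective univ SwitchSetting.position_top_injective]
    refine (card_le_card hsub).trans (card_biUnion_le_card_mul _ _ _ fun D _ => ?_)
    rw [Fintype.card_piFinset]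
    calc ∏ t, (univ.filter fun x => owner k x = D t).card ≤ ∏ _t : Fin k → Bool, q := by
          refine prod_le_prod' fun t _ => le_trans (le_of_eq ?_) (hq (D t))
          rw [← Set.ncard_coe_finset]
          congr 1
          ext x
          simp
      _ = q ^ 2 ^ k := by simp
  calc (2 : ℝ) ^ (k * 2 ^ (k - 1))
      ≤ (univ.image (tokenLocation owner sent J)).card * (q : ℝ) ^ 2 ^ k := by exact_mod_cast h1
    _ ≤ _ := by
        gcongr
        exact card_tokenLocation_le hp hs h hh J

end counting

/-! ### Paths of the butterfly across a cut -/

/-- Every node of the butterfly lies on `2 ^ k` of the `4 ^ k` paths from the inputs to the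
outputs; so the paths that enter `S` need many nodes at which they do so. -/
theorem card_mul_card_le_entries {k : ℕ} (S : ℕ → Set (Fin k → Bool)) :
    (S 0)ᶜ.ncard * (S k).ncard ≤ 2 ^ k *
      {u : Fin k × (Fin k → Bool) |
        u.2 ∉ S u.1 ∧ ∃ y, ButterflyArc u.1 u.2 y ∧ y ∈ S (u.1 + 1)}.ncard := by
  classical
  set E := {u : Fin k × (Fin k → Bool) |
    u.2 ∉ S u.1 ∧ ∃ y, ButterflyArc u.1 u.2 y ∧ y ∈ S (u.1 + 1)} with hE
  let z : (Fin k → Bool) × (Fin k → Bool) → ℕ → Fin k → Bool := fun a m i =>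
    if (i : ℕ) < m then a.2 i else a.1 i
  have hex : ∀ a : (Fin k → Bool) × (Fin k → Bool), a ∈ (S 0)ᶜ ×ˢ (S k) →
      ∃ l : Fin k, z a l ∉ S l ∧ z a (l + 1) ∈ S (l + 1) := by
    intro a ha
    by_contra hcon
    push Not at hcon
    have h0 : ∀ m ≤ k, z a m ∉ S m := by
      intro m hm
      induction m with
      | zero => simpa [z] using ha.1
      | succ m ih => exact hcon ⟨m, hm⟩ (ih (by omega))
    refine h0 k le_rfl ?_
    have : z a k = a.2 := by
      funext i
      simp [z]
    rw [this]
    exact ha.2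
  choose l hl using hex
  -- The entry node shows the first `l` coordinates of the output and the others of the input; the
  -- second component stores exactly the complementary coordinates, so the pair can be recovered.
  let f : ↥((S 0)ᶜ ×ˢ (S k)) → ↥E × (Fin k → Bool) := fun a =>
    (⟨(l a.1 a.2, z a.1 (l a.1 a.2)), (hl a.1 a.2).1, z a.1 (l a.1 a.2 + 1), fun i hi => by
        have hi : (i : ℕ) ≠ l a.1 a.2 := hi
        simp only [z]
        congr 1
        exact propext (by omega), (hl a.1 a.2).2⟩,
      fun i => if (i : ℕ) < l a.1 a.2 then a.1.1 i else a.1.2 i)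
  have hf : Function.Injective f := by
    intro a b hab
    simp only [f, Prod.mk.injEq, Subtype.mk.injEq] at hab
    obtain ⟨⟨h1, h2⟩, h3⟩ := hab
    rw [h1] at h2 h3
    have hi : ∀ i, a.1.1 i = b.1.1 i ∧ a.1.2 i = b.1.2 i := by
      intro i
      have h2 := congrFun h2 i
      have h3 := congrFun h3 i
      simp only [z] at h2 h3
      split_ifs at h2 h3
      · exact ⟨h3, h2⟩
      · exact ⟨h2, h3⟩
    exact Subtype.ext (Prod.ext (funext fun i => (hi i).1) (funext fun i => (hi i).2))
  have := Nat.card_le_card_of_injective f hf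
  rw [Nat.card_prod, Nat.card_coe_set_eq, Nat.card_coe_set_eq, Set.ncard_prod] at this
  simpa [mul_comm] using this

/-- A processor that owns at most half of the outputs of the butterfly receives and sends, taken
together, at least as many nodes as it owns outputs. -/
theorem ncard_outputs_le {k p : ℕ} (owner : ℕ → (Fin k → Bool) → Fin p) (P : Fin p) {H : ℕ}
    (hhalf : 2 * {x | owner k x = P}.ncard ≤ 2 ^ k)
    (hrecv : {u : Fin k × (Fin k → Bool) | owner u.1 u.2 ≠ P ∧
      ∃ y, ButterflyArc u.1 u.2 y ∧ owner (u.1 + 1) y = P}.ncard ≤ H)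
    (hsend : {u : Fin k × (Fin k → Bool) | owner u.1 u.2 = P ∧
      ∃ y, ButterflyArc u.1 u.2 y ∧ owner (u.1 + 1) y ≠ P}.ncard ≤ H) :
    {x | owner k x = P}.ncard ≤ 2 * H := by
  have h1 := card_mul_card_le_entries fun l => {x : Fin k → Bool | owner l x = P}
  have h2 := card_mul_card_le_entries fun l => {x : Fin k → Bool | owner l x = P}ᶜ
  simp only [compl_compl, Set.mem_compl_iff, Set.mem_ofPred_eq, not_not] at h1 h2
  have c0 := Set.ncard_add_ncard_compl {x : Fin k → Bool | owner 0 x = P}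
  have ck := Set.ncard_add_ncard_compl {x : Fin k → Bool | owner k x = P}
  have hn : Nat.card (Fin k → Bool) = 2 ^ k := by simp
  rw [hn] at c0 ck
  replace h1 := h1.trans (Nat.mul_le_mul_left _ hrecv)
  replace h2 := h2.trans (Nat.mul_le_mul_left _ hsend)
  generalize {x : Fin k → Bool | owner 0 x = P}.ncard = a at *
  generalize {x : Fin k → Bool | owner k x = P}.ncard = o at *
  generalize {x : Fin k → Bool | owner 0 x = P}ᶜ.ncard = a' at *
  generalize {x : Fin k → Bool | owner k x = P}ᶜ.ncard = o' at *
  have hpos : 0 < 2 ^ k := by positivity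
  refine Nat.le_of_mul_le_mul_left ?_ hpos
  -- Entering paths number `a' * o`, leaving paths `a * o'`; since `o ≤ o'`, their sum is at least
  -- `2 ^ k * o`.
  have h3 : a * o ≤ a * o' := Nat.mul_le_mul_left _ (by omega)
  calc 2 ^ k * o = a' * o + a * o := by rw [← c0]; ring
    _ ≤ a' * o + a * o' := by omega
    _ ≤ 2 ^ k * H + 2 ^ k * H := by omega
    _ = _ := by ring

/-! ### The numerical bound for one block. -/

/-- The threshold is `log (2 * q) = (k - 1) / 4`: above it the cut bound `q ≤ 2 * H` suffices, below
it the counting bound. -/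
theorem block_inequality {k p q H : ℕ} (hp : 0 < p) (hM : Real.exp 1 ≤ 2 * 2 ^ k / p)
    (hk : 1 ≤ k) (hpq : 2 ^ k ≤ p * q) (hqH : q ≤ 2 * H)
    (h : (2 : ℝ) ^ (k * 2 ^ (k - 1)) ≤ (2 * 2 ^ k / p + 1 : ℝ) ^ (p * H) * q ^ 2 ^ k) :
    (2 : ℝ) ^ k * (k - 1) < 8 * p * H * Real.logb 2 (2 * 2 ^ k / p) := by
  have hp' : (0 : ℝ) < p := by exact_mod_cast hp
  have hpq' : (2 : ℝ) ^ k ≤ p * q := by exact_mod_cast hpq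
  have hqH' : (q : ℝ) ≤ 2 * H := by exact_mod_cast hqH
  have hn : (0 : ℝ) < 2 ^ k := by positivity
  have hq : (0 : ℝ) < q := by
    by_contra hcon
    have : (p : ℝ) * q ≤ 0 := mul_nonpos_of_nonneg_of_nonpos hp'.le (not_lt.1 hcon)
    linarith
  set M : ℝ := 2 * 2 ^ k / p with hMdef
  have he := Real.add_one_le_exp (1 : ℝ)
  have hM2 : 2 ≤ M := by linarith
  have hlogM : 0 < Real.logb 2 M := Real.logb_pos (by norm_num) (by linarith)
  have hlog2 : 0 < Real.log 2 := Real.log_pos (by norm_num)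
  have hl2q : Real.logb 2 (2 * q) = 1 + Real.logb 2 q := by
    rw [Real.logb_mul (by norm_num) hq.ne', Real.logb_self_eq_one (by norm_num)]
  rcases lt_or_ge (((k : ℝ) - 1) / 4) (1 + Real.logb 2 q) with hc | hc
  · have hMq : M ≤ 2 * q := by
      rw [hMdef, div_le_iff₀ hp']
      linarith
    -- `log x / x` decreases from `e` on, and `e ≤ M ≤ 2 * q`; this is the role of `p ≤ 2 * n / e`.
    have hanti : Real.logb 2 (2 * q) / (2 * q) ≤ Real.logb 2 M / M := by
      have h1 : Real.log (2 * q) / (2 * q) ≤ Real.log M / M :=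
        Real.log_div_self_antitoneOn hM (hM.trans hMq) hMq
      unfold Real.logb
      rw [div_right_comm, div_right_comm (Real.log M)]
      gcongr
    have h1 : (2 : ℝ) ^ k * Real.logb 2 (2 * q) ≤ p * q * Real.logb 2 M := by
      have hMp : M * p = 2 * 2 ^ k := by rw [hMdef]; field_simp
      rw [div_le_div_iff₀ (by positivity) (by linarith)] at hanti
      have := mul_le_mul_of_nonneg_right hanti hp'.le
      rw [mul_assoc, hMp] at this
      linarith
    have h2 : (p : ℝ) * q * Real.logb 2 M ≤ p * (2 * H) * Real.logb 2 M := by gcongr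
    rw [hl2q] at h1
    nlinarith
  · have hlog := Real.logb_le_logb_of_le (b := 2) (by norm_num) (by positivity) h
    rw [Real.logb_mul (by positivity) (by positivity), Real.logb_pow, Real.logb_pow,
      Real.logb_pow, Real.logb_self_eq_one (by norm_num)] at hlog
    have hM1 : Real.logb 2 (M + 1) ≤ 2 * Real.logb 2 M := by
      calc Real.logb 2 (M + 1) ≤ Real.logb 2 (M ^ 2) :=
            Real.logb_le_logb_of_le (by norm_num) (by linarith) (by nlinarith)
        _ = _ := by rw [Real.logb_pow]; norm_num
    have h2k : (2 : ℝ) * 2 ^ (k - 1) = 2 ^ k := by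
      rw [← pow_succ', Nat.sub_add_cancel hk]
    push_cast at hlog
    have h3 : (p : ℝ) * H * Real.logb 2 (M + 1) ≤ p * H * (2 * Real.logb 2 M) := by gcongr
    have h4 : (2 : ℝ) ^ k * Real.logb 2 q ≤ 2 ^ k * ((k - 1) / 4 - 1) := by
      gcongr
      linarith
    have h5 : (k : ℝ) * 2 ^ k = 2 * (k * 2 ^ (k - 1)) := by rw [← h2k]; ring
    -- With `n = 2 ^ k`, what remains is `n * (k / 2 - (k - 1) / 4 + 1) ≤ 2 * p * H * log M`, that
    -- is, `n * (k + 5) ≤ 8 * p * H * log M`.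
    nlinarith

/-! ### The balanced merging network is a butterfly -/

/-- The Gray code of `w`, the coordinate `0` being the most significant bit. -/
def grayCode (k : ℕ) (w : Fin (2 ^ k)) : Fin k → Bool := fun l =>
  xor ((w : ℕ).testBit (k - 1 - l)) ((w : ℕ).testBit (k - l))

theorem grayCode_injective (k : ℕ) : Function.Injective (grayCode k) := by
  intro w w' h
  have hge : ∀ v : Fin (2 ^ k), ∀ t, k ≤ t → (v : ℕ).testBit t = false := fun v t ht =>
    Nat.testBit_lt_two_pow (v.isLt.trans_le (Nat.pow_le_pow_right (by norm_num) ht))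
  have key : ∀ m ≤ k, (w : ℕ).testBit (k - m) = (w' : ℕ).testBit (k - m) := by
    intro m hm
    induction m with
    | zero => rw [hge w _ (by omega), hge w' _ (by omega)]
    | succ m ih =>
      have h1 := congrFun h ⟨m, hm⟩
      simp only [grayCode] at h1
      rw [ih (by omega), Bool.xor_left_inj, Nat.sub_sub, Nat.add_comm 1 m] at h1
      exact h1
  refine Fin.ext (Nat.eq_of_testBit_eq fun t => ?_)
  rcases Nat.lt_or_ge t k with ht | ht
  · have := key (k - t) (by omega)
    rwa [Nat.sub_sub_self ht.le] at this
  · rw [hge w t ht, hge w' t ht]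

/-- The Gray code as a bijection. -/
noncomputable def grayEquiv (k : ℕ) : Fin (2 ^ k) ≃ (Fin k → Bool) :=
  Equiv.ofBijective (grayCode k)
    ((Fintype.bijective_iff_injective_and_card _).2 ⟨grayCode_injective k, by simp⟩)

/-- Subtraction from `2 ^ r - 1` complements the `r` low bits, and the group of `a` is given by the
higher ones. -/
theorem testBit_mirror (a r t : ℕ) :
    ((a / 2 ^ r + 1) * 2 ^ r - 1 - a % 2 ^ r).testBit t =
      if t < r then !a.testBit t else a.testBit t := by
  have hlt : a % 2 ^ r < 2 ^ r := Nat.mod_lt _ (by positivity)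
  have h1 : (a / 2 ^ r + 1) * 2 ^ r - 1 - a % 2 ^ r =
      2 ^ r * (a / 2 ^ r) + (2 ^ r - (a % 2 ^ r + 1)) := by
    rw [Nat.add_mul, mul_comm]
    omega
  rw [h1, Nat.testBit_two_pow_mul_add _ (by omega)]
  split_ifs with h
  · rw [Nat.testBit_two_pow_sub_succ hlt, Nat.testBit_mod_two_pow]
    simp [h]
  · rw [Nat.testBit_div_two_pow]
    congr 1
    omega

/-- The mirror arc complements the `k - l` low bits. A Gray coordinate is the sum of two adjacent
bits, so only the one at the border of the complemented part changes, and this is coordinate `l`. -/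
theorem BMNArc_of_butterflyArc {k : ℕ} (l : Fin k) {w v : Fin (2 ^ k)}
    (h : ButterflyArc l (grayCode k w) (grayCode k v)) :
    BMNArc k (w, l.castSucc) (v, l.succ) := by
  refine ⟨rfl, ?_⟩
  have hl := l.isLt
  have hdiv : 2 ^ k / 2 ^ (l : ℕ) = 2 ^ (k - l) := Nat.pow_div hl.le (by norm_num)
  have hi : (w : ℕ) * 2 ^ (l : ℕ) / 2 ^ k = w / 2 ^ (k - l) := by
    rw [← Nat.mul_div_mul_right (w : ℕ) (2 ^ (k - l)) (by positivity : 0 < 2 ^ (l : ℕ)),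
      ← pow_add, Nat.sub_add_cancel hl.le]
  simp only [Fin.val_castSucc, hdiv, hi]
  by_cases hw : grayCode k v l = grayCode k w l
  · left
    refine grayCode_injective k (funext fun i => ?_)
    by_cases hil : i = l
    · rw [hil, hw]
    · exact (h i fun h' => hil (Fin.ext h')).symm
  · right
    have hlt : ((w : ℕ) / 2 ^ (k - l) + 1) * 2 ^ (k - l) - 1 - (w : ℕ) % 2 ^ (k - l) < 2 ^ k := by
      have h1 : (w : ℕ) / 2 ^ (k - l) < 2 ^ (l : ℕ) := by
        rw [Nat.div_lt_iff_lt_mul (by positivity), ← pow_add, Nat.add_sub_cancel' hl.le]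
        exact w.isLt
      have h2 : ((w : ℕ) / 2 ^ (k - l) + 1) * 2 ^ (k - l) ≤ 2 ^ (l : ℕ) * 2 ^ (k - l) :=
        Nat.mul_le_mul_right _ h1
      rw [← pow_add, Nat.add_sub_cancel' hl.le] at h2
      have h3 : 0 < 2 ^ k := by positivity
      omega
    suffices v = ⟨_, hlt⟩ from congrArg Fin.val this
    refine grayCode_injective k (funext fun i => ?_)
    simp only [grayCode, testBit_mirror]
    rcases lt_trichotomy (i : ℕ) l with hil | hil | hil
    · rw [if_neg (by omega), if_neg (by omega)]
      exact (h i hil.ne).symm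
    · obtain rfl : i = l := Fin.ext hil
      rw [if_pos (by omega), if_neg (by omega)]
      have := Bool.eq_not_of_ne hw
      simp only [grayCode] at this
      rw [this, Bool.not_xor]
    · rw [if_pos (by omega), if_pos (by omega)]
      have := h i hil.ne'
      simp only [grayCode] at this
      rw [← this]
      simp

/-! ### Butterfly coordinates in the blocks of the sorting network. -/

/-- The node of the periodic balanced sorting network at a level, with a given Gray code. -/
noncomputable def sortingNode (k L : ℕ) (x : Fin k → Bool) : PBSNNode k :=
  -- The minimum only makes the node total in `L`.
  ((grayEquiv k).symm x, ⟨min L (k * k), by omega⟩)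

theorem sortingNode_inj {k L L' : ℕ} {x x' : Fin k → Bool} (hL : L ≤ k * k) (hL' : L' ≤ k * k)
    (h : sortingNode k L x = sortingNode k L' x') : L = L' ∧ x = x' := by
  have h1 := congrArg (fun v : PBSNNode k => (v.2 : ℕ)) h
  have h2 := congrArg Prod.fst h
  simp only [sortingNode, min_eq_left hL, min_eq_left hL'] at h1
  exact ⟨h1, (grayEquiv k).symm.injective h2⟩

theorem blockLevel_lt {k b l : ℕ} (hb : b < k) (hl : l < k) : b * k + l < k * k := by
  have : (b + 1) * k ≤ k * k := Nat.mul_le_mul_right k hb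
  rw [Nat.succ_mul] at this
  omega

theorem adj_sortingNode {k b l : ℕ} (hb : b < k) (hl : l < k) {x y : Fin k → Bool}
    (h : ButterflyArc l x y) :
    (PBSN k).Adj (sortingNode k (b * k + l) x) (sortingNode k (b * k + l + 1) y) := by
  have h1 := blockLevel_lt hb hl
  refine ⟨⟨b, hb⟩, ((grayEquiv k).symm x, (⟨l, hl⟩ : Fin k).castSucc),
    ((grayEquiv k).symm y, (⟨l, hl⟩ : Fin k).succ), BMNArc_of_butterflyArc ⟨l, hl⟩ ?_, ?_, ?_⟩
  · have hg : ∀ z, grayCode k ((grayEquiv k).symm z) = z := (grayEquiv k).apply_symm_apply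
    rw [hg, hg]
    exact h
  · refine Prod.ext rfl (Fin.ext ?_)
    simp only [sortingNode, blockNode, Fin.val_castSucc]
    omega
  · refine Prod.ext rfl (Fin.ext ?_)
    simp only [sortingNode, blockNode, Fin.val_succ]
    omega

/-! ### Executions without recomputation -/

namespace BSPExecution

section generic

variable {V : Type*} {p : ℕ} {A : BSPExecution V p} {G : CompDAG V}

/-- The processor-time pair at which a node is evaluated. -/
noncomputable def event (hA1 : A.WithoutRecomputation) (v : V) : ProcTime p A.steps :=
  (hA1 v).choose

theorem mem_sched_iff (hA1 : A.WithoutRecomputation) {v : V} {e : ProcTime p A.steps} :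
    e ∈ A.sched v ↔ e = event hA1 v := by
  rw [event]
  conv_lhs => rw [(hA1 v).choose_spec]
  exact Set.mem_singleton_iff

/-- Forwarded values are traced back, superstep by superstep, to the only processor that evaluates
the node. -/
theorem exists_message_of_message (hA : A.Evaluates G) (hA1 : A.WithoutRecomputation) {u : V} :
    ∀ (j : Fin A.steps) (P Q : Fin p), some u ∈ A.messages j P Q →
      (event hA1 u).step ≤ j ∧ ∃ i ≤ j, ∃ R, some u ∈ A.messages i (event hA1 u).proc R := by
  intro j
  induction j using WellFoundedLT.induction with
  | ind j ih =>
    intro P Q h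
    rcases hA.message j P Q u h with ⟨f, hf, rfl, hj⟩ | ⟨i, hij, R, hR⟩
    · obtain rfl := (mem_sched_iff hA1).1 hf
      exact ⟨hj, j, le_rfl, Q, h⟩
    · obtain ⟨h1, i', h2, h3⟩ := ih i hij R P hR
      exact ⟨h1.trans hij.le, i', h2.trans hij.le, h3⟩

theorem step_le_of_adj (hA : A.Evaluates G) (hA1 : A.WithoutRecomputation) {u v : V}
    (h : G.Adj u v) : (event hA1 u).step ≤ (event hA1 v).step := by
  rcases hA.operand u v h _ ((mem_sched_iff hA1).2 rfl) with ⟨f, hf, -, hb⟩ | ⟨i, hi, Q, hQ⟩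
  · obtain rfl := (mem_sched_iff hA1).1 hf
    rcases hb with hb | hb
    · exact hb.le
    · exact hb.1.le
  · exact (exists_message_of_message hA hA1 i Q _ hQ).1.trans hi.le

theorem exists_received_of_adj (hA : A.Evaluates G) (hA1 : A.WithoutRecomputation) {u v : V}
    (h : G.Adj u v) (hne : (event hA1 u).proc ≠ (event hA1 v).proc) :
    ∃ i, (event hA1 u).step ≤ i ∧ i < (event hA1 v).step ∧
      ∃ Q, some u ∈ A.messages i Q (event hA1 v).proc := by
  rcases hA.operand u v h _ ((mem_sched_iff hA1).2 rfl) with ⟨f, hf, hp, -⟩ | ⟨i, hi, Q, hQ⟩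
  · obtain rfl := (mem_sched_iff hA1).1 hf
    exact absurd hp hne
  · exact ⟨i, (exists_message_of_message hA hA1 i Q _ hQ).1, hi, Q, hQ⟩

/-- The first superstep in which the value of a node is sent by the processor that evaluates it. -/
noncomputable def firstSendTime (hA1 : A.WithoutRecomputation) (u : V) : ℕ :=
  sInf {j | ∃ i : Fin A.steps, (i : ℕ) = j ∧ ∃ Q, some u ∈ A.messages i (event hA1 u).proc Q}

/-- Even if `v` gets the operand through relays, the owner of `u` must have sent it before `v` is
evaluated. This places every crossing between the evaluations of the two ends of its arc. -/
theorem exists_eq_firstSendTime (hA : A.Evaluates G) (hA1 : A.WithoutRecomputation) {u v : V}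
    (h : G.Adj u v) (hne : (event hA1 u).proc ≠ (event hA1 v).proc) :
    ∃ i : Fin A.steps, (i : ℕ) = firstSendTime hA1 u ∧ (event hA1 u).step ≤ i ∧
      i < (event hA1 v).step ∧ ∃ Q, some u ∈ A.messages i (event hA1 u).proc Q := by
  obtain ⟨i, -, hi, Q, hQ⟩ := exists_received_of_adj hA hA1 h hne
  obtain ⟨-, i', hi', hQ'⟩ := exists_message_of_message hA hA1 i Q _ hQ
  have hmem : (i' : ℕ) ∈ {j | ∃ i : Fin A.steps, (i : ℕ) = j ∧
    ∃ Q, some u ∈ A.messages i (event hA1 u).proc Q} := ⟨i', rfl, hQ'⟩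
  obtain ⟨i'', h1, R, hR⟩ := Nat.sInf_mem ⟨_, hmem⟩
  refine ⟨i'', h1, (exists_message_of_message hA hA1 i'' _ R hR).1, ?_, R, hR⟩
  have : (i'' : ℕ) ≤ i' := h1 ▸ Nat.sInf_le hmem
  exact lt_of_le_of_lt (Fin.le_def.2 this) (hi'.trans_lt hi)

theorem ncard_le_card_multiset {T : Set V} {m : Multiset (Option V)} (h : ∀ u ∈ T, some u ∈ m) :
    T.ncard ≤ m.card := by
  classical
  have h1 : (some '' T) ⊆ (m.toFinset : Set (Option V)) := by
    rintro _ ⟨u, hu, rfl⟩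
    simpa using h u hu
  calc T.ncard = (some '' T).ncard := (Set.ncard_image_of_injective _ (Option.some_injective V)).symm
    _ ≤ (m.toFinset : Set (Option V)).ncard := Set.ncard_le_ncard h1 (Finset.finite_toSet _)
    _ = m.toFinset.card := Set.ncard_coe_finset _
    _ ≤ _ := m.toFinset_card_le

theorem ncard_le_sum_degree_of_sent {T : Set V} (W : Finset (Fin A.steps)) (P : Fin p)
    (h : ∀ u ∈ T, ∃ j ∈ W, ∃ Q, some u ∈ A.messages j P Q) : T.ncard ≤ ∑ j ∈ W, A.degree j := by
  refine (ncard_le_card_multiset (m := ∑ j ∈ W, ∑ Q, A.messages j P Q) fun u hu => ?_).trans ?_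
  · obtain ⟨j, hj, Q, hQ⟩ := h u hu
    exact Multiset.mem_sum.2 ⟨j, hj, Multiset.mem_sum.2 ⟨Q, mem_univ _, hQ⟩⟩
  · simp only [Multiset.card_sum]
    exact sum_le_sum fun j _ => (le_max_left _ _).trans
      (le_sup (f := fun P : Fin p => max (∑ Q, (A.messages j P Q).card)
        (∑ Q, (A.messages j Q P).card)) (mem_univ P))

theorem ncard_le_sum_degree_of_received {T : Set V} (W : Finset (Fin A.steps)) (P : Fin p)
    (h : ∀ u ∈ T, ∃ j ∈ W, ∃ Q, some u ∈ A.messages j Q P) : T.ncard ≤ ∑ j ∈ W, A.degree j := by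
  refine (ncard_le_card_multiset (m := ∑ j ∈ W, ∑ Q, A.messages j Q P) fun u hu => ?_).trans ?_
  · obtain ⟨j, hj, Q, hQ⟩ := h u hu
    exact Multiset.mem_sum.2 ⟨j, hj, Multiset.mem_sum.2 ⟨Q, mem_univ _, hQ⟩⟩
  · simp only [Multiset.card_sum]
    exact sum_le_sum fun j _ => (le_max_right _ _).trans
      (le_sup (f := fun P : Fin p => max (∑ Q, (A.messages j P Q).card)
        (∑ Q, (A.messages j Q P).card)) (mem_univ P))

end generic

/-! ### Communication within a block -/

section block

variable {k p : ℕ} {A : BSPExecution (PBSNNode k) p}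

/-- The superstep in which the node with the given level and Gray code is evaluated. -/
noncomputable def nodeStep (hA1 : A.WithoutRecomputation) (L : ℕ) (x : Fin k → Bool) :
    Fin A.steps :=
  (event hA1 (sortingNode k L x)).step

open Classical in
/-- The supersteps from the evaluation of the first input of a block up to, but excluding, the
evaluation of its last output. -/
noncomputable def blockWindow (hA1 : A.WithoutRecomputation) (b : ℕ) : Finset (Fin A.steps) :=
  univ.filter fun j => (∃ x, nodeStep hA1 (b * k) x ≤ j) ∧ ∃ y, j < nodeStep hA1 (b * k + k) y

theorem nodeStep_le_succ (hA : A.Evaluates (PBSN k)) (hA1 : A.WithoutRecomputation) {b l : ℕ}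
    (hb : b < k) (hl : l < k) {x y : Fin k → Bool} (h : ButterflyArc l x y) :
    nodeStep hA1 (b * k + l) x ≤ nodeStep hA1 (b * k + l + 1) y :=
  step_le_of_adj hA hA1 (adj_sortingNode hb hl h)

theorem nodeStep_le_of_path (hA : A.Evaluates (PBSN k)) (hA1 : A.WithoutRecomputation) {b : ℕ}
    (hb : b < k) (u : ℕ → Fin k → Bool) (hu : ∀ l < k, ButterflyArc l (u l) (u (l + 1)))
    {l l' : ℕ} (hl : l ≤ l') (hl' : l' ≤ k) :
    nodeStep hA1 (b * k + l) (u l) ≤ nodeStep hA1 (b * k + l') (u l') := by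
  induction l', hl using Nat.le_induction with
  | base => exact le_rfl
  | succ m hm ih => exact (ih (by omega)).trans (nodeStep_le_succ hA hA1 hb hl' (hu m hl'))

/-- Every output of a block depends on every input of the block. -/
theorem nodeStep_input_le_output (hA : A.Evaluates (PBSN k)) (hA1 : A.WithoutRecomputation)
    {b : ℕ} (hb : b < k) (x y : Fin k → Bool) :
    nodeStep hA1 (b * k) x ≤ nodeStep hA1 (b * k + k) y := by
  have := nodeStep_le_of_path hA hA1 hb (fun m i => if (i : ℕ) < m then y i else x i)
    (fun l _ i hi => by
      simp only
      congr 1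
      exact propext (by omega)) (Nat.zero_le k) le_rfl
  simpa using this

theorem nodeStep_mono_block (hA : A.Evaluates (PBSN k)) (hA1 : A.WithoutRecomputation) {b b' : ℕ}
    (h : b ≤ b') (hb' : b' < k) (x : Fin k → Bool) :
    nodeStep hA1 (b * k) x ≤ nodeStep hA1 (b' * k) x := by
  induction b', h using Nat.le_induction with
  | base => exact le_rfl
  | succ m hm ih =>
    refine (ih (by omega)).trans ?_
    rw [Nat.succ_mul]
    exact nodeStep_input_le_output hA hA1 (by omega) x x

/-- The last output of block `b` is an input of block `b + 1`, for which all outputs of that block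
wait, and with them the inputs of block `b'`. -/
theorem disjoint_blockWindow (hA : A.Evaluates (PBSN k)) (hA1 : A.WithoutRecomputation) {b b' : ℕ}
    (h : b + 2 ≤ b') (hb' : b' < k) : Disjoint (blockWindow hA1 b) (blockWindow hA1 b') := by
  refine disjoint_left.2 fun j hj hj' => ?_
  obtain ⟨-, -, y, hy⟩ := mem_filter.1 hj
  obtain ⟨-, ⟨x, hx⟩, -⟩ := mem_filter.1 hj'
  have h1 := nodeStep_input_le_output hA hA1 (b := b + 1) (by omega) y x
  have h2 := nodeStep_mono_block hA hA1 h hb' x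
  rw [Nat.succ_mul b k] at h1
  rw [show (b + 2) * k = b * k + k + k by ring] at h2
  exact absurd (((hy.trans_le h1).trans_le h2).trans_le hx) (lt_irrefl _)

theorem mem_blockWindow (hA : A.Evaluates (PBSN k)) (hA1 : A.WithoutRecomputation) {b l : ℕ}
    (hb : b < k) (hl : l < k) {x y : Fin k → Bool} {j : Fin A.steps}
    (hx : nodeStep hA1 (b * k + l) x ≤ j) (hy : j < nodeStep hA1 (b * k + l + 1) y) :
    j ∈ blockWindow hA1 b := by
  refine mem_filter.2 ⟨mem_univ _, ⟨x, ?_⟩, y, ?_⟩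
  · exact (nodeStep_le_of_path hA hA1 hb (fun _ => x) (fun _ _ _ _ => rfl) (Nat.zero_le l)
      hl.le).trans hx
  · exact hy.trans_le (nodeStep_le_of_path hA hA1 hb (fun _ => y) (fun _ _ _ _ => rfl)
      (Nat.succ_le_of_lt hl) le_rfl)

/-- The processors that evaluate the nodes of a block. -/
noncomputable def blockOwner (hA1 : A.WithoutRecomputation) (b l : ℕ) (x : Fin k → Bool) : Fin p :=
  (event hA1 (sortingNode k (b * k + l) x)).proc

/-- The supersteps in which the nodes of a block are first sent by their owners. -/
noncomputable def blockSent (hA1 : A.WithoutRecomputation) (b l : ℕ) (x : Fin k → Bool) : ℕ :=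
  firstSendTime hA1 (sortingNode k (b * k + l) x)

theorem exists_eq_blockSent (hA : A.Evaluates (PBSN k)) (hA1 : A.WithoutRecomputation) {b l : ℕ}
    (hb : b < k) (hl : l < k) {x y : Fin k → Bool} (h : ButterflyArc l x y)
    (hne : blockOwner hA1 b l x ≠ blockOwner hA1 b (l + 1) y) :
    ∃ i : Fin A.steps, (i : ℕ) = blockSent hA1 b l x ∧ nodeStep hA1 (b * k + l) x ≤ i ∧
      i < nodeStep hA1 (b * k + l + 1) y ∧
      ∃ Q, some (sortingNode k (b * k + l) x) ∈ A.messages i (blockOwner hA1 b l x) Q :=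
  exists_eq_firstSendTime hA hA1 (adj_sortingNode hb hl h) hne

/-- A value sent in one superstep is usable only in a later one, so a token crosses at most once per
superstep. -/
theorem crossingsOrdered_block (hA : A.Evaluates (PBSN k)) (hA1 : A.WithoutRecomputation) {b : ℕ}
    (hb : b < k) : CrossingsOrdered (blockOwner hA1 b) (blockSent hA1 b) := by
  intro u hu l l' hl hl' hne hne'
  obtain ⟨i, hi, -, h1, -⟩ := exists_eq_blockSent hA hA1 hb (hl.trans hl') (hu l (hl.trans hl')) hne
  obtain ⟨i', hi', h2, -, -⟩ := exists_eq_blockSent hA hA1 hb hl' (hu l' hl') hne'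
  rw [← hi, ← hi', ← Fin.lt_def]
  exact (h1.trans_le (nodeStep_le_of_path hA hA1 hb u hu (Nat.succ_le_of_lt hl) hl'.le)).trans_le h2

theorem ncard_image_sortingNode {b : ℕ} (hb : b < k) (T : Set (Fin k × (Fin k → Bool))) :
    ((fun u : Fin k × (Fin k → Bool) => sortingNode k (b * k + u.1) u.2) '' T).ncard = T.ncard := by
  refine Set.ncard_image_of_injective _ fun u u' h => ?_
  obtain ⟨h1, h2⟩ := sortingNode_inj (blockLevel_lt hb u.1.isLt).le
    (blockLevel_lt hb u'.1.isLt).le h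
  exact Prod.ext (Fin.ext (by omega)) h2

theorem ncard_firstSent_le (hA : A.Evaluates (PBSN k)) (hA1 : A.WithoutRecomputation) {b : ℕ}
    (hb : b < k) (j : ℕ) (P : Fin p) :
    (firstSent (blockOwner hA1 b) (blockSent hA1 b) j P).ncard ≤
      ∑ i ∈ (blockWindow hA1 b).filter (fun i : Fin A.steps => (i : ℕ) = j), A.degree i := by
  rw [← ncard_image_sortingNode hb]
  refine ncard_le_sum_degree_of_sent _ P ?_
  rintro _ ⟨u, ⟨h1, h2, y, hy, hne⟩, rfl⟩
  obtain ⟨i, hi, h3, h4, hQ⟩ := exists_eq_blockSent hA hA1 hb u.1.isLt hy (h1.trans_ne hne.symm)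
  rw [h1] at hQ
  exact ⟨i, mem_filter.2 ⟨mem_blockWindow hA hA1 hb u.1.isLt h3 h4, hi.trans h2⟩, hQ⟩

theorem ncard_sent_le (hA : A.Evaluates (PBSN k)) (hA1 : A.WithoutRecomputation) {b : ℕ}
    (hb : b < k) (P : Fin p) :
    {u : Fin k × (Fin k → Bool) | blockOwner hA1 b u.1 u.2 = P ∧
      ∃ y, ButterflyArc u.1 u.2 y ∧ blockOwner hA1 b (u.1 + 1) y ≠ P}.ncard ≤
      ∑ i ∈ blockWindow hA1 b, A.degree i := by
  rw [← ncard_image_sortingNode hb]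
  refine ncard_le_sum_degree_of_sent _ P ?_
  rintro _ ⟨u, ⟨h1, y, hy, hne⟩, rfl⟩
  obtain ⟨i, hi, h3, h4, hQ⟩ := exists_eq_blockSent hA hA1 hb u.1.isLt hy (h1.trans_ne hne.symm)
  rw [h1] at hQ
  exact ⟨i, mem_blockWindow hA hA1 hb u.1.isLt h3 h4, hQ⟩

theorem ncard_received_le (hA : A.Evaluates (PBSN k)) (hA1 : A.WithoutRecomputation) {b : ℕ}
    (hb : b < k) (P : Fin p) :
    {u : Fin k × (Fin k → Bool) | blockOwner hA1 b u.1 u.2 ≠ P ∧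
      ∃ y, ButterflyArc u.1 u.2 y ∧ blockOwner hA1 b (u.1 + 1) y = P}.ncard ≤
      ∑ i ∈ blockWindow hA1 b, A.degree i := by
  rw [← ncard_image_sortingNode hb]
  refine ncard_le_sum_degree_of_received _ P ?_
  rintro _ ⟨u, ⟨h1, y, hy, rfl⟩, rfl⟩
  obtain ⟨i, h3, h4, hQ⟩ := exists_received_of_adj hA hA1 (adj_sortingNode hb u.1.isLt hy) h1
  exact ⟨i, mem_blockWindow hA hA1 hb u.1.isLt h3 h4, hQ⟩

theorem ncard_blockOwner_le (hA1 : A.WithoutRecomputation) {b : ℕ} (hb : b < k) (P : Fin p) :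
    {x | blockOwner hA1 b k x = P}.ncard ≤ A.maxBlockOutputCount := by
  have h1 : A.blockOutputCount ⟨b, hb⟩ P = {x | blockOwner hA1 b k x = P}.ncard := by
    rw [← Set.ncard_image_of_injective _ (grayEquiv k).symm.injective, blockOutputCount]
    congr 1
    ext w
    have hw : blockOutput k ⟨b, hb⟩ w = sortingNode k (b * k + k) (grayEquiv k w) := by
      have : (b + 1) * k ≤ k * k := Nat.mul_le_mul_right k hb
      rw [Nat.succ_mul] at this
      refine Prod.ext (by simp [blockOutput, blockNode, sortingNode]) (Fin.ext ?_)
      simp only [blockOutput, blockNode, sortingNode, Fin.val_last]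
      omega
    constructor
    · rintro ⟨e, he, hP⟩
      obtain rfl := (mem_sched_iff hA1).1 he
      rw [hw] at hP
      exact ⟨grayEquiv k w, hP, (grayEquiv k).symm_apply_apply w⟩
    · rintro ⟨x, hx, rfl⟩
      refine ⟨_, (mem_sched_iff hA1).2 rfl, ?_⟩
      rw [hw, Equiv.apply_symm_apply]
      exact hx
  have h2 : ∀ x : Fin k × Fin p, A.blockOutputCount x.1 x.2 ≤ A.maxBlockOutputCount := fun x => by
    rw [maxBlockOutputCount]
    exact Finset.le_sup (f := fun x : Fin k × Fin p => A.blockOutputCount x.1 x.2) (mem_univ x)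
  exact h1.symm.trans_le (h2 (⟨b, hb⟩, P))

/-- The communication that is due to a single block. -/
theorem lt_sum_degree_blockWindow (hA : A.Evaluates (PBSN k)) (hA1 : A.WithoutRecomputation)
    (hp : 0 < p) (hM : Real.exp 1 ≤ 2 * 2 ^ k / p) (hq : 2 * A.maxBlockOutputCount ≤ 2 ^ k)
    {b : ℕ} (hb : b < k) :
    (2 : ℝ) ^ k * (k - 1) <
      8 * p * (∑ i ∈ blockWindow hA1 b, A.degree i : ℕ) * Real.logb 2 (2 * 2 ^ k / p) := by
  -- The maximum is over this block alone, since `q ≤ 2 * H` must hold with the communication of its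
  -- own window.
  set q : ℕ := univ.sup fun P : Fin p => {x | blockOwner hA1 b k x = P}.ncard with hqdef
  have hqP : ∀ P, {x | blockOwner hA1 b k x = P}.ncard ≤ q := fun P =>
    le_sup (f := fun P : Fin p => {x | blockOwner hA1 b k x = P}.ncard) (mem_univ P)
  refine block_inequality (q := q) hp hM (by omega) ?_ ?_ ?_
  · have h1 : ∑ P, (univ.filter fun x => blockOwner hA1 b k x = P).card = 2 ^ k := by
      rw [← card_eq_sum_card_fiberwise (fun t _ => mem_univ (blockOwner hA1 b k t))]
      simp
    calc 2 ^ k = ∑ P, (univ.filter fun x => blockOwner hA1 b k x = P).card := h1.symm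
      _ ≤ ∑ _P : Fin p, q := by
        refine sum_le_sum fun P _ => le_trans (le_of_eq ?_) (hqP P)
        rw [← Set.ncard_coe_finset]
        congr 1
        ext x
        simp
      _ = p * q := by simp
  · refine Finset.sup_le fun P _ => ncard_outputs_le (blockOwner hA1 b) P ?_
      (ncard_received_le hA hA1 hb P) (ncard_sent_le hA hA1 hb P)
    have := ncard_blockOwner_le hA1 hb P
    omega
  -- Time `j` is charged the degree of superstep `j` if it lies in the window, and `0` otherwise.
  · have := two_pow_le_of_crossingsOrdered hp (crossingsOrdered_block hA hA1 hb)
      (fun j => ∑ i ∈ (blockWindow hA1 b).filter (fun i : Fin A.steps => (i : ℕ) = j), A.degree i)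
      (ncard_firstSent_le hA hA1 hb) A.steps (fun l hl x y h hne => by
        obtain ⟨i, hi, -⟩ := exists_eq_blockSent hA hA1 hb hl h hne
        exact hi ▸ i.isLt) q hqP
    rwa [sum_fiberwise_of_maps_to (fun i _ => mem_range.2 i.isLt)] at this

end block

end BSPExecution

/-! ### Summation over alternate blocks. -/

theorem ceil_half (k : ℕ) : ⌈(k : ℝ) / 2⌉ = ((k + 1) / 2 : ℕ) := by
  rw [Int.ceil_eq_iff]
  rcases Nat.even_or_odd' k with ⟨c, rfl | rfl⟩
  · rw [show (2 * c + 1) / 2 = c by omega]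
    push_cast
    constructor <;> linarith
  · rw [show (2 * c + 1 + 1) / 2 = c + 1 by omega]
    push_cast
    constructor <;> linarith

theorem theorem5 (n k p q : ℕ) (hn : n = 2 ^ k) (hp : (p : ℝ) ≤ 2 * n / Real.exp 1)
    (A : BSPExecution (PBSNNode k) p)
    (hA : A.Evaluates (PBSN k)) (hA1 : A.WithoutRecomputation)
    (hinit : ∀ v, (PBSN k).IsInput v → ∃! P : Fin p, v ∈ A.initial P)
    (hq : q = A.maxBlockOutputCount) (hqn : (q : ℝ) ≤ n / 2) :
    (A.commComplexity : ℝ) >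
      n * Real.logb 2 (n / 2) / (8 * p * Real.logb 2 (2 * n / p)) *
        (⌈Real.logb 2 n / 2⌉ : ℝ) := by
  classical
  subst hn hq
  push_cast at hp hqn ⊢
  have hp0 : 0 < p := (BSPExecution.event hA1 (sortingNode k 0 fun _ => false)).proc.pos
  have hp' : (0 : ℝ) < p := by exact_mod_cast hp0
  have hp1 : (1 : ℝ) ≤ p := by exact_mod_cast hp0
  have he := Real.exp_one_gt_d9
  have hM : Real.exp 1 ≤ 2 * 2 ^ k / p := by
    rw [le_div_iff₀ (Real.exp_pos 1)] at hp
    rw [le_div_iff₀ hp', mul_comm]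
    exact hp
  -- For `k = 0` the ratio `2 * n / p` is at most `2`, which is less than `e`.
  have hk : 1 ≤ k := by
    by_contra hk
    obtain rfl : k = 0 := by omega
    rw [le_div_iff₀ hp'] at hM
    nlinarith
  have hq2 : 2 * A.maxBlockOutputCount ≤ 2 ^ k := by
    have : 2 * (A.maxBlockOutputCount : ℝ) ≤ 2 ^ k := by linarith
    exact_mod_cast this
  have hlogM : 0 < Real.logb 2 (2 * 2 ^ k / p) := Real.logb_pos (by norm_num) (by linarith)
  have hlogn : Real.logb 2 (2 ^ k) = k := by
    rw [Real.logb_pow, Real.logb_self_eq_one (by norm_num), mul_one]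
  rw [Real.logb_div (by positivity) (by norm_num), hlogn, Real.logb_self_eq_one (by norm_num),
    ceil_half]
  set r : ℝ := 2 ^ k * (k - 1) / (8 * p * Real.logb 2 (2 * 2 ^ k / p)) with hr
  -- The blocks used are `0, 2, 4, ...`, whose windows are pairwise disjoint.
  have hblock : ∀ c ∈ range ((k + 1) / 2),
      r < (∑ i ∈ BSPExecution.blockWindow hA1 (2 * c), A.degree i : ℕ) := by
    intro c hc
    have hb : 2 * c < k := by
      have := mem_range.1 hc
      omega
    have := BSPExecution.lt_sum_degree_blockWindow hA hA1 hp0 hM hq2 hb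
    rw [hr, div_lt_iff₀ (by positivity)]
    linarith
  have hdisj : (↑(range ((k + 1) / 2)) : Set ℕ).PairwiseDisjoint
      fun c => BSPExecution.blockWindow hA1 (2 * c) := by
    intro c hc c' hc' hne
    have h1 := mem_range.1 hc
    have h2 := mem_range.1 hc'
    rcases Nat.lt_or_gt_of_ne hne with h | h
    · exact BSPExecution.disjoint_blockWindow hA hA1 (by omega) (by omega)
    · exact (BSPExecution.disjoint_blockWindow hA hA1 (by omega) (by omega)).symm
  have hsum : ∑ c ∈ range ((k + 1) / 2), ∑ i ∈ BSPExecution.blockWindow hA1 (2 * c), A.degree i ≤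
      A.commComplexity := by
    rw [← sum_biUnion hdisj]
    exact sum_le_sum_of_subset (subset_univ _)
  calc r * (((k + 1) / 2 : ℕ) : ℤ) = ∑ _c ∈ range ((k + 1) / 2), r := by
        rw [sum_const, card_range, nsmul_eq_mul, mul_comm, Int.cast_natCast]
    _ < ∑ c ∈ range ((k + 1) / 2),
          ((∑ i ∈ BSPExecution.blockWindow hA1 (2 * c), A.degree i : ℕ) : ℝ) :=
        sum_lt_sum_of_nonempty (nonempty_range_iff.2 (by omega)) hblock
    _ ≤ A.commComplexity := by
        rw [← Nat.cast_sum]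
        exact_mod_cast hsum
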